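/- Let $m\ge 1$, let $M\subset\mathbb R^{m+1}$ be a smooth embedded submanifold of dimension $m$ (codimension one), and let $x\in M$. For $y\in M$, $y\neq x$, put $$\Omega_y(x)=\frac{2\sin(\theta(x,y)/2)}{\|x-y\|},$$ where $\theta(x,y)\in[0,\pi/2]$ is the angle between the hyperplanes $T_xM$ and $T_yM$, and for $\varepsilon>0$ let $A_\varepsilon=\{y\in M:\|x-y\|=\varepsilon\}$, with $(m-1)$-dimensional volume $\mu$ (counting measure if $m=1$). The absolute variation curvature of $M$ at $x$ is $$\omega_x=\lim_{\varepsilon\to0^+}\frac1{\mu(A_\varepsilon)}\int_{A_\varepsilon}\Omega_y(x)\,d\mu(y).$$ There is a smooth unit normal field $\mathbf n$ of $M$ on a neighbourhood of $x$ in $M$. For any such $\mathbf n$ let $\mathcal L_xY=-D_Y\mathbf n$ $(Y\in T_xM)$ be the shape operator, and let $$\psi(\mathcal L_x)=\frac1{\operatorname{vol}(S)}\int_{S}\|\mathcal L_xY\|\,dY,\qquad S=\{Y\in T_xM:\|Y\|=1\},$$ be the mean of $\|\mathcal L_xY\|$ over the unit tangent vectors at $x$. Then, for all sufficiently small $\varepsilon>0$,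 $0<\mu(A_\varepsilon)<\infty$ and $y\mapsto\Omega_y(x)$ is integrable on $A_\varepsilon$; the limit defining $\omega_x$ exists; and $$\omega_x=\psi(\mathcal L_x).$$ Moreover $\Omega_y(x)=\|\mathbf n(x)-\mathbf n(y)\|/\|x-y\|$ for all $y\in M\setminus\{x\}$ sufficiently close to $x$, so that also $$\lim_{\varepsilon\to0^+}\frac1{\mu(A_\varepsilon)}\int_{A_\varepsilon}\frac{\|\mathbf n(x)-\mathbf n(y)\|}{\|x-y\|}\,d\mu(y)=\psi(\mathcal L_x).$$ -/

import Mathlib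

open MeasureTheory Filter Topology
open scoped ContDiff

noncomputable section

/-- `M ⊆ ℝⁿ` is a smooth embedded submanifold of dimension `k`: around each of its points there is
a smooth diffeomorphism between open subsets of `ℝⁿ` which carries `M` to a `k`-dimensional linear
subspace. -/
def IsSmoothSubmanifold {n : ℕ} (k : ℕ) (M : Set (EuclideanSpace ℝ (Fin n))) : Prop :=
  ∀ p ∈ M, ∃ (Φ : OpenPartialHomeomorph (EuclideanSpace ℝ (Fin n)) (EuclideanSpace ℝ (Fin n)))
    (V : Submodule ℝ (EuclideanSpace ℝ (Fin n))),
    p ∈ Φ.source ∧ ContDiffOn ℝ ∞ Φ Φ.source ∧ ContDiffOn ℝ ∞ Φ.symm Φ.target ∧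
      Module.finrank ℝ V = k ∧ ∀ y ∈ Φ.source, y ∈ M ↔ Φ y ∈ V

/-- The tangent space `T_x M`: the velocities at time `0` of curves in `M` through `x`. (For a
submanifold these velocities already form a linear subspace; the span makes this a subspace for
every set.) -/
def tangentSpaceAt {n : ℕ} (M : Set (EuclideanSpace ℝ (Fin n))) (x : EuclideanSpace ℝ (Fin n)) :
    Submodule ℝ (EuclideanSpace ℝ (Fin n)) :=
  Submodule.span ℝ {v | ∃ γ : ℝ → EuclideanSpace ℝ (Fin n),
    γ 0 = x ∧ (∀ᶠ t in 𝓝 (0 : ℝ), γ t ∈ M) ∧ HasDerivAt γ v 0}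

/-- The angle between two hyperplanes: the smallest angle between a nonzero normal of the one and a
nonzero normal of the other. -/
def hyperplaneAngle {n : ℕ} (V W : Submodule ℝ (EuclideanSpace ℝ (Fin n))) : ℝ :=
  sInf {θ | ∃ u ∈ Vᗮ, ∃ v ∈ Wᗮ, u ≠ 0 ∧ v ≠ 0 ∧ θ = InnerProductGeometry.angle u v}

/-- The discrete variation curvature `Ω_y(x)` of a hypersurface at `x` in the direction of `y`. -/
def discreteVariationCurvature {n : ℕ} (M : Set (EuclideanSpace ℝ (Fin n)))
    (x y : EuclideanSpace ℝ (Fin n)) : ℝ :=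
  2 * Real.sin (hyperplaneAngle (tangentSpaceAt M x) (tangentSpaceAt M y) / 2) / ‖x - y‖

/-- The small sphere `A_ε` in `M` around `x`. -/
def smallSphere {n : ℕ} (M : Set (EuclideanSpace ℝ (Fin n))) (x : EuclideanSpace ℝ (Fin n))
    (ε : ℝ) : Set (EuclideanSpace ℝ (Fin n)) :=
  {y ∈ M | ‖x - y‖ = ε}

/-- The absolute variation curvature `ω(x)` of a hypersurface `M ⊆ ℝᵐ⁺¹`: the limit, as `ε → 0⁺`, of
the mean of `Ω_y(x)` over `A_ε` with respect to its `(m - 1)`-dimensional volume. -/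
def absoluteVariationCurvature {m : ℕ} (M : Set (EuclideanSpace ℝ (Fin (m + 1))))
    (x : EuclideanSpace ℝ (Fin (m + 1))) : ℝ :=
  limUnder (𝓝[>] (0 : ℝ)) fun ε =>
    ⨍ y in smallSphere M x ε, discreteVariationCurvature M x y ∂μHE[m - 1]

/-- `N` is a smooth unit normal field of `M` near `x`. (Its values away from `M`, or far from `x`,
play no role.) -/
def IsUnitNormalNear {n : ℕ} (M : Set (EuclideanSpace ℝ (Fin n))) (x : EuclideanSpace ℝ (Fin n))
    (N : EuclideanSpace ℝ (Fin n) → EuclideanSpace ℝ (Fin n)) : Prop :=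
  ∃ U ∈ 𝓝 x, ContDiffOn ℝ ∞ N (M ∩ U) ∧
    ∀ y ∈ M ∩ U, ‖N y‖ = 1 ∧ N y ∈ (tangentSpaceAt M y)ᗮ

/-- The shape operator `L_x Y = -D_Y N` for `Y ∈ T_x M`, where `D_Y` is differentiation along `M`.
(Derivatives of `N` within `M` may differ only off `T_x M`, so the restriction to `T_x M` is
well defined.) -/
def shapeOperator {n : ℕ} (M : Set (EuclideanSpace ℝ (Fin n)))
    (N : EuclideanSpace ℝ (Fin n) → EuclideanSpace ℝ (Fin n)) (x : EuclideanSpace ℝ (Fin n)) :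
    tangentSpaceAt M x →L[ℝ] EuclideanSpace ℝ (Fin n) :=
  -((fderivWithin ℝ N M x).comp (tangentSpaceAt M x).subtypeL)

/-- `ψ(T)`: the mean of `‖T Y‖` over the unit sphere of `V`, with respect to the volume of the
sphere, whose dimension is `dim V - 1`. -/
def sphereMean {n : ℕ} {V : Submodule ℝ (EuclideanSpace ℝ (Fin n))}
    (T : V →L[ℝ] EuclideanSpace ℝ (Fin n)) : ℝ :=
  ⨍ Y in Metric.sphere (0 : V) 1, ‖T Y‖ ∂μHE[Module.finrank ℝ V - 1]

end

/-! Near `x` the hypersurface is a regular level set `φ = 0`, and its tangent spaces are the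
orthogonal complements of the gradient of `φ`. For `y` close to `x` continuity gives `⟪N x, N y⟫ >
0`, so the angle between the tangent hyperplanes is the angle between these unit normals and `2 sin
(θ / 2)` is the chord `‖N x - N y‖` (`two_mul_sin_hyperplaneAngle_half`). Differentiability of `N`
within `M` then replaces `Ω_y(x)` by `‖L ((y - x) / ‖y - x‖)‖` up to a uniformly small error.

It remains to compare the mean over `A_ε` with the mean over the unit sphere of `T_x M`. Strict
differentiability of `φ` makes every chord of `M` near `x` almost parallel to `T_x M`. Hence radial
projection maps `A_ε` to the unit sphere as a similarity of ratio `1 / ε`, up to factors tending to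
`1` (`dist_radialProjection_bounds`); an intermediate value argument makes it onto
(`eventually_exists_radialProjection_eq`). Lipschitz bounds both ways sandwich the pushed-forward
Hausdorff measure between multiples of the measure on the sphere. Averages ignore a common scale, so
only the product of the two constants matters, and it tends to `1`. -/

/-! ### Hausdorff measure of the unit sphere -/

open scoped NNReal ENNReal in
theorem LipschitzOnWith.euclideanHausdorffMeasure_image_le {X Y : Type*} [MetricSpace X]
    [MeasurableSpace X] [BorelSpace X] [MetricSpace Y] [MeasurableSpace Y] [BorelSpace Y]
    {K : ℝ≥0} {f : X → Y} {s : Set X} (h : LipschitzOnWith K f s) (d : ℕ) :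
    μHE[d] (f '' s) ≤ (K : ℝ≥0∞) ^ d * μHE[d] s := by
  simp_rw [Measure.euclideanHausdorffMeasure_def, Measure.smul_apply, ENNReal.smul_def, smul_eq_mul]
  rw [mul_left_comm]
  gcongr
  simpa using h.hausdorffMeasure_image_le (d := d) (by positivity)

-- Two opposite closed hemispheres cover the sphere. Each lies in the image of a closed ball of a
-- hyperplane under inverse stereographic projection, which is Lipschitz on compact sets.
open scoped NNReal ENNReal in
theorem euclideanHausdorffMeasure_sphere_lt_top {V : Type*} [NormedAddCommGroup V]
    [InnerProductSpace ℝ V] [FiniteDimensional ℝ V] [MeasurableSpace V] [BorelSpace V]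
    (hV : 1 ≤ Module.finrank ℝ V) :
    μHE[Module.finrank ℝ V - 1] (Metric.sphere (0 : V) 1) < ⊤ := by
  have : Nontrivial V := Module.nontrivial_of_finrank_pos (R := ℝ) (by omega)
  obtain ⟨v, hv⟩ := exists_norm_eq V zero_le_one
  have key : ∀ v : V, ‖v‖ = 1 → μHE[Module.finrank ℝ V - 1]
      {y : V | ‖y‖ = 1 ∧ inner ℝ v y ≤ 0} < ⊤ := by
    intro v hv
    have : Fact (Module.finrank ℝ V = (Module.finrank ℝ V - 1) + 1) := ⟨by omega⟩
    have hfr : Module.finrank ℝ (ℝ ∙ v)ᗮ = Module.finrank ℝ V - 1 :=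
      Submodule.finrank_orthogonal_span_singleton (by
        rintro rfl; simp at hv)
    let F : (ℝ ∙ v)ᗮ → V := fun w => stereoInvFunAux v w
    have hF : ContDiff ℝ 1 F :=
      contDiff_stereoInvFunAux.comp (ℝ ∙ v)ᗮ.subtypeL.contDiff
    have hloc : LocallyLipschitzOn (Metric.closedBall (0 : (ℝ ∙ v)ᗮ) 2) F :=
      hF.locallyLipschitz.locallyLipschitzOn
    obtain ⟨K, hK⟩ := hloc.exists_lipschitzOnWith_of_compact (isCompact_closedBall _ _)
    have hsub : {y : V | ‖y‖ = 1 ∧ inner ℝ v y ≤ 0} ⊆ F '' Metric.closedBall 0 2 := by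
      rintro y ⟨hy, hvy⟩
      have hne : y ≠ v := by
        rintro rfl
        rw [real_inner_self_eq_norm_sq, hy] at hvy
        norm_num at hvy
      refine ⟨stereoToFun v y, ?_, ?_⟩
      · rw [mem_closedBall_zero_iff, stereoToFun_apply, norm_smul]
        -- On the hemisphere away from the pole `v` the denominator is at least `1`; hence the
        -- radius `2`.
        have h1 : ‖(2 / (1 - innerSL ℝ v y) : ℝ)‖ ≤ 2 := by
          rw [innerSL_apply_apply, Real.norm_eq_abs, abs_of_pos (div_pos two_pos (by linarith))]
          exact div_le_self two_pos.le (by linarith)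
        have h2 := (ℝ ∙ v)ᗮ.norm_orthogonalProjectionOnto_apply_le y
        rw [hy] at h2
        calc _ ≤ 2 * 1 := mul_le_mul h1 h2 (norm_nonneg _) two_pos.le
          _ = 2 := by norm_num
      · exact congrArg Subtype.val
          (stereo_left_inv hv (x := ⟨y, by simpa using hy⟩) hne)
    refine (measure_mono hsub).trans_lt
      ((hK.euclideanHausdorffMeasure_image_le _).trans_lt (ENNReal.mul_lt_top (by simp) ?_))
    rw [← hfr, InnerProductSpace.euclideanHausdorffMeasure_eq_volume]
    exact measure_closedBall_lt_top
  refine (measure_mono (t := {y : V | ‖y‖ = 1 ∧ inner ℝ v y ≤ 0} ∪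
    {y : V | ‖y‖ = 1 ∧ inner ℝ (-v) y ≤ 0}) ?_).trans_lt
    (measure_union_lt_top (key v hv) (key (-v) (by simpa using hv)))
  intro y hy
  rw [mem_sphere_zero_iff_norm] at hy
  rcases le_total (inner ℝ v y) 0 with h | h
  · exact Or.inl ⟨hy, h⟩
  · exact Or.inr ⟨hy, by simpa using h⟩

-- Orthogonal projection to a hyperplane does not increase Hausdorff measure, and the image of the
-- sphere contains the open unit ball of the hyperplane.
open scoped NNReal ENNReal in
theorem euclideanHausdorffMeasure_sphere_pos {V : Type*} [NormedAddCommGroup V]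
    [InnerProductSpace ℝ V] [FiniteDimensional ℝ V] [MeasurableSpace V] [BorelSpace V]
    (hV : 1 ≤ Module.finrank ℝ V) :
    0 < μHE[Module.finrank ℝ V - 1] (Metric.sphere (0 : V) 1) := by
  have : Nontrivial V := Module.nontrivial_of_finrank_pos (R := ℝ) (by omega)
  obtain ⟨v, hv⟩ := exists_norm_eq V zero_le_one
  have : Fact (Module.finrank ℝ V = (Module.finrank ℝ V - 1) + 1) := ⟨by omega⟩
  have hfr : Module.finrank ℝ (ℝ ∙ v)ᗮ = Module.finrank ℝ V - 1 :=
    Submodule.finrank_orthogonal_span_singleton (by rintro rfl; simp at hv)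
  have hlip : LipschitzOnWith 1 ((ℝ ∙ v)ᗮ.orthogonalProjectionOnto) (Metric.sphere (0 : V) 1) :=
    (LipschitzWith.of_dist_le_mul fun a b => by
      rw [dist_eq_norm, dist_eq_norm, ← map_sub]
      simpa using (ℝ ∙ v)ᗮ.norm_orthogonalProjectionOnto_apply_le (a - b)).lipschitzOnWith
  have hle := hlip.euclideanHausdorffMeasure_image_le (Module.finrank ℝ V - 1)
  simp only [ENNReal.coe_one, one_pow, one_mul] at hle
  refine lt_of_lt_of_le ?_ hle
  have hsub : Metric.ball (0 : (ℝ ∙ v)ᗮ) 1 ⊆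
      (ℝ ∙ v)ᗮ.orthogonalProjectionOnto '' Metric.sphere (0 : V) 1 := by
    intro w hw
    rw [mem_ball_zero_iff] at hw
    have hvw : inner ℝ (w : V) v = 0 :=
      Submodule.inner_left_of_mem_orthogonal (Submodule.mem_span_singleton_self v) w.2
    have h0 : 0 ≤ 1 - ‖w‖ ^ 2 := by nlinarith [norm_nonneg w]
    refine ⟨w + √(1 - ‖w‖ ^ 2) • v, ?_, ?_⟩
    · rw [mem_sphere_zero_iff_norm, ← sq_eq_sq₀ (norm_nonneg _) zero_le_one, norm_add_sq_real,
        inner_smul_right, hvw, norm_smul, hv, Real.norm_of_nonneg (Real.sqrt_nonneg _), mul_one,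
        Real.sq_sqrt h0]
      simp
    · have : (ℝ ∙ v)ᗮ.orthogonalProjectionOnto v = 0 := by
        rw [Submodule.orthogonalProjectionOnto_eq_zero_iff, Submodule.orthogonal_orthogonal]
        exact Submodule.mem_span_singleton_self v
      rw [map_add, map_smul, this]
      simp
  refine lt_of_lt_of_le ?_ (measure_mono hsub)
  rw [← hfr, InnerProductSpace.euclideanHausdorffMeasure_eq_volume]
  exact Metric.measure_ball_pos _ _ one_pos

/-! ### Averages under almost-similarities -/

open scoped NNReal ENNReal in
/-- Two mutually comparable measures have comparable averages. -/
theorem abs_average_sub_average_le {β : Type*} [MeasurableSpace β] {σ ν : Measure β}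
    [IsFiniteMeasure σ] (hσ : σ ≠ 0) {a b : ℝ≥0} (h₁ : ν ≤ a • σ) (h₂ : σ ≤ b • ν)
    (hab : 1 ≤ a * b) {g : β → ℝ} (hg : Integrable g σ) (hg0 : ∀ y, 0 ≤ g y) :
    |⨍ y, g y ∂ν - ⨍ y, g y ∂σ| ≤ (a * b - 1) * ⨍ y, g y ∂σ := by
  have hgν : Integrable g ν := (hg.smul_measure_nnreal (c := a)).mono_measure h₁
  have hνfin : IsFiniteMeasure ν := isFiniteMeasure_of_le _ h₁
  have hσu : 0 < σ.real Set.univ := by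
    rw [measureReal_def]; exact ENNReal.toReal_pos (by simpa using hσ) (measure_ne_top _ _)
  have u1 : ν.real Set.univ ≤ a * σ.real Set.univ := by
    have := ENNReal.toReal_mono (measure_ne_top _ _) (h₁ Set.univ)
    rwa [Measure.smul_apply, ENNReal.smul_def, smul_eq_mul, ENNReal.toReal_mul] at this
  have u2 : σ.real Set.univ ≤ b * ν.real Set.univ := by
    have := ENNReal.toReal_mono (measure_ne_top _ _) (h₂ Set.univ)
    rwa [Measure.smul_apply, ENNReal.smul_def, smul_eq_mul, ENNReal.toReal_mul] at this
  have i1 : ∫ y, g y ∂ν ≤ a * ∫ y, g y ∂σ := by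
    have := integral_mono_measure h₁ (Eventually.of_forall hg0) (hg.smul_measure_nnreal (c := a))
    rwa [integral_smul_nnreal_measure, NNReal.smul_def, smul_eq_mul] at this
  have i2 : ∫ y, g y ∂σ ≤ b * ∫ y, g y ∂ν := by
    have := integral_mono_measure h₂ (Eventually.of_forall hg0) (hgν.smul_measure_nnreal (c := b))
    rwa [integral_smul_nnreal_measure, NNReal.smul_def, smul_eq_mul] at this
  have hνu : 0 < ν.real Set.univ := by
    by_contra h
    have : (b : ℝ) * ν.real Set.univ ≤ 0 := mul_nonpos_of_nonneg_of_nonpos b.2 (not_lt.1 h)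
    linarith
  have hI : 0 ≤ ∫ y, g y ∂σ := integral_nonneg hg0
  have hJ : 0 ≤ ∫ y, g y ∂ν := integral_nonneg hg0
  have hab' : (1 : ℝ) ≤ a * b := by exact_mod_cast hab
  rw [average_eq, average_eq, smul_eq_mul, smul_eq_mul]
  set I := ∫ y, g y ∂σ
  set J := ∫ y, g y ∂ν
  set s := σ.real Set.univ
  set t := ν.real Set.univ
  have k1 : t⁻¹ * J ≤ a * b * (s⁻¹ * I) := by
    rw [inv_mul_eq_div, inv_mul_eq_div, div_le_iff₀ hνu]
    calc J ≤ a * I := i1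
      _ = a * (I / s) * s := by field_simp
      _ ≤ a * (I / s) * (b * t) := by gcongr
      _ = _ := by ring
  have k2 : s⁻¹ * I ≤ a * b * (t⁻¹ * J) := by
    rw [inv_mul_eq_div, inv_mul_eq_div, div_le_iff₀ hσu]
    calc I ≤ b * J := i2
      _ = b * (J / t) * t := by field_simp
      _ ≤ b * (J / t) * (a * s) := by gcongr
      _ = _ := by ring
  have p1 : 0 ≤ s⁻¹ * I := by positivity
  have p2 : 0 ≤ t⁻¹ * J := by positivity
  -- With averages `p` for `σ` and `q` for `ν`, the lower bound follows from `p - q ≤ (1 - 1 / (a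
  -- b)) p ≤ (a b - 1) p`.
  rw [abs_le]
  constructor <;> nlinarith

-- The Lipschitz bounds on `P` and its inverse bound the pushforward of the measure on `A` above and
-- below by multiples of the measure on `S`. The error involves only `a * b`, so `A` may be much
-- smaller than `S`.
open scoped NNReal ENNReal in
theorem abs_setAverage_sub_setAverage_le {X Y : Type*} [MetricSpace X]
    [MeasurableSpace X] [BorelSpace X] [MetricSpace Y] [MeasurableSpace Y] [BorelSpace Y]
    {A : Set X} {S : Set Y} (hA : MeasurableSet A) {d : ℕ}
    (hS0 : 0 < μHE[d] S) (hSfin : μHE[d] S < ⊤) {P : X → Y} (hP : Measurable P)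
    (hPA : P '' A = S) {a b : ℝ≥0} (hab : 1 ≤ a * b)
    (hlip : LipschitzOnWith b P A)
    (hanti : ∀ y ∈ A, ∀ z ∈ A, dist y z ≤ a * dist (P y) (P z)) :
    0 < μHE[d] A ∧ μHE[d] A < ⊤ ∧
    ∀ {f : X → ℝ} {g : Y → ℝ} {η : ℝ},
      AEStronglyMeasurable f (μHE[d].restrict A) → IntegrableOn g S μHE[d] → (∀ y, 0 ≤ g y) →
      (∀ y ∈ A, |f y - g (P y)| ≤ η) →
      IntegrableOn f A μHE[d] ∧
      |⨍ y in A, f y ∂μHE[d] - ⨍ y in S, g y ∂μHE[d]| ≤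
        η + ((a * b) ^ d - 1) * ⨍ y in S, g y ∂μHE[d] := by
  set σ : Measure Y := μHE[d].restrict S with hσdef
  set μ : Measure X := μHE[d].restrict A with hμdef
  set ν : Measure Y := μ.map P with hνdef
  have hσ : σ ≠ 0 := by
    rw [hσdef, Ne, Measure.restrict_eq_zero]; exact hS0.ne'
  have : IsFiniteMeasure σ := ⟨by simpa [hσdef] using hSfin⟩
  have h₁ : ν ≤ (a ^ d) • σ := by
    refine Measure.le_iff.2 fun B hB => ?_
    rw [hνdef, Measure.map_apply hP hB, hμdef, Measure.restrict_apply (hP hB), Measure.smul_apply,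
      hσdef, Measure.restrict_apply hB, ENNReal.smul_def, smul_eq_mul, ENNReal.coe_pow]
    -- `Function.invFunOn` needs a nonempty domain.
    rcases isEmpty_or_nonempty X with hX | hX
    · simp [Set.eq_empty_of_isEmpty]
    have hinj : Set.InjOn P A := fun y hy z hz h => by
      have := hanti y hy z hz
      rw [h, dist_self, mul_zero] at this
      exact dist_le_zero.1 this
    have hG : LipschitzOnWith a (Function.invFunOn P A) (B ∩ S) := by
      refine LipschitzOnWith.of_dist_le_mul fun u hu w hw => ?_
      have hu' : u ∈ P '' A := hPA ▸ hu.2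
      have hw' : w ∈ P '' A := hPA ▸ hw.2
      have := hanti _ (Function.invFunOn_mem hu') _ (Function.invFunOn_mem hw')
      rwa [Function.invFunOn_eq hu', Function.invFunOn_eq hw'] at this
    refine (measure_mono ?_).trans (hG.euclideanHausdorffMeasure_image_le d)
    rintro y ⟨hyB, hyA⟩
    exact ⟨P y, ⟨hyB, hPA ▸ Set.mem_image_of_mem P hyA⟩, hinj.leftInvOn_invFunOn hyA⟩
  have h₂ : σ ≤ (b ^ d) • ν := by
    refine Measure.le_iff.2 fun B hB => ?_
    rw [Measure.smul_apply, hνdef, Measure.map_apply hP hB, hμdef, Measure.restrict_apply (hP hB),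
      hσdef, Measure.restrict_apply hB, ENNReal.smul_def, smul_eq_mul, ENNReal.coe_pow]
    refine (measure_mono ?_).trans
      ((hlip.mono Set.inter_subset_right).euclideanHausdorffMeasure_image_le d)
    rintro u ⟨huB, huS⟩
    obtain ⟨y, hy, rfl⟩ : u ∈ P '' A := hPA ▸ huS
    exact ⟨y, ⟨huB, hy⟩, rfl⟩
  have hνfin : IsFiniteMeasure ν := isFiniteMeasure_of_le _ h₁
  have hνA : ν Set.univ = μHE[d] A := by
    rw [hνdef, Measure.map_apply hP .univ]; simp [hμdef]
  have hA0 : 0 < μHE[d] A := by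
    rw [← hνA, pos_iff_ne_zero]
    intro h0
    have := h₂ Set.univ
    rw [Measure.smul_apply, h0, smul_zero] at this
    exact hσ (Measure.measure_univ_eq_zero.1 (le_antisymm this bot_le))
  have hAfin : μHE[d] A < ⊤ := hνA ▸ measure_lt_top ν _
  refine ⟨hA0, hAfin, fun {f g η} hf hg hg0 hfg => ?_⟩
  have hμfin : IsFiniteMeasure μ := ⟨by simpa [hμdef] using hAfin⟩
  have hgν : Integrable g ν := (Integrable.smul_measure_nnreal hg (c := a ^ d)).mono_measure h₁
  have hgP : Integrable (fun y => g (P y)) μ := hgν.comp_measurable hP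
  have hae : ∀ᵐ y ∂μ, ‖f y - g (P y)‖ ≤ η :=
    (ae_restrict_iff' hA).2 (Eventually.of_forall hfg)
  have hdiff : Integrable (fun y => f y - g (P y)) μ :=
    Integrable.of_bound (hf.sub hgP.aestronglyMeasurable) η hae
  have hfint : Integrable f μ := (hdiff.add hgP).congr
    (Eventually.of_forall fun y => sub_add_cancel (f y) (g (P y)))
  refine ⟨hfint, ?_⟩
  have hμu : 0 < μ.real Set.univ := by
    rw [measureReal_def]
    exact ENNReal.toReal_pos (by simpa [hμdef] using hA0.ne') (measure_ne_top _ _)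
  have e1 : |⨍ y, f y ∂μ - ⨍ y, g (P y) ∂μ| ≤ η := by
    rw [average_eq, average_eq, ← smul_sub, ← integral_sub hfint hgP, smul_eq_mul, abs_mul,
      abs_of_pos (inv_pos.2 hμu), inv_mul_le_iff₀ hμu, mul_comm]
    exact norm_integral_le_of_norm_le_const hae
  have e2 : ⨍ y, g (P y) ∂μ = ⨍ u, g u ∂ν := by
    rw [average_eq, average_eq, hνdef, integral_map hP.aemeasurable hgν.aestronglyMeasurable]
    simp [measureReal_def, Measure.map_apply hP .univ]
  have e3 := abs_average_sub_average_le hσ h₁ h₂ (by rw [← mul_pow]; exact one_le_pow₀ hab) hg hg0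
  rw [← e2] at e3
  calc _ ≤ |⨍ y, f y ∂μ - ⨍ y, g (P y) ∂μ| + |⨍ y, g (P y) ∂μ - ⨍ u, g u ∂σ| := abs_sub_le _ _ _
    _ ≤ _ := by
      refine (add_le_add e1 e3).trans_eq ?_
      push_cast
      rw [mul_pow]

/-! ### Radial projection to a subspace -/

/-- The direction, as seen in the subspace `K`, in which `y` lies from `x`. -/
noncomputable def radialProjection {E : Type*} [NormedAddCommGroup E] [InnerProductSpace ℝ E]
    (K : Submodule ℝ E) [K.HasOrthogonalProjection] (x y : E) : K :=
  ‖K.orthogonalProjectionOnto (y - x)‖⁻¹ • K.orthogonalProjectionOnto (y - x)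

section RadialProjection

variable {E : Type*} [NormedAddCommGroup E] [InnerProductSpace ℝ E]
  {K : Submodule ℝ E} [K.HasOrthogonalProjection] {x : E}

theorem measurable_radialProjection [MeasurableSpace E] [BorelSpace E] :
    Measurable (radialProjection K x) := by
  unfold radialProjection
  have h : Continuous fun y => K.orthogonalProjectionOnto (y - x) := by fun_prop
  have h' : Measurable fun y => ‖K.orthogonalProjectionOnto (y - x)‖⁻¹ :=
    h.norm.measurable.inv
  exact h'.smul h.measurable

theorem norm_sq_eq_orthogonalProjectionOnto_add (v : E) :
    ‖v‖ ^ 2 = ‖K.orthogonalProjectionOnto v‖ ^ 2 + ‖v - K.orthogonalProjectionOnto v‖ ^ 2 := by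
  have h : inner ℝ (K.orthogonalProjectionOnto v : E) (v - K.orthogonalProjectionOnto v) = 0 :=
    Submodule.inner_right_of_mem_orthogonal (K.orthogonalProjectionOnto v).2
      (K.sub_starProjection_mem_orthogonal v)
  have := norm_add_sq_real (K.orthogonalProjectionOnto v : E) (v - K.orthogonalProjectionOnto v)
  rw [h, add_sub_cancel] at this
  rw [this, Submodule.coe_norm]
  ring

variable {δ ε : ℝ} {y z : E}

theorem one_sub_mul_le_norm_orthogonalProjectionOnto {v : E}
    (h : ‖v - K.orthogonalProjectionOnto v‖ ≤ δ * ‖v‖) :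
    (1 - δ) * ‖v‖ ≤ ‖K.orthogonalProjectionOnto v‖ := by
  have := norm_le_norm_add_norm_sub' v (K.orthogonalProjectionOnto v : E)
  rw [Submodule.coe_norm]
  linarith

theorem norm_radialProjection (h : K.orthogonalProjectionOnto (y - x) ≠ 0) :
    ‖radialProjection K x y‖ = 1 := by
  rw [radialProjection, norm_smul, norm_inv, norm_norm, inv_mul_cancel₀ (norm_ne_zero_iff.2 h)]

theorem norm_smul_radialProjection (h : K.orthogonalProjectionOnto (y - x) ≠ 0) :
    ‖K.orthogonalProjectionOnto (y - x)‖ • radialProjection K x y =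
      K.orthogonalProjectionOnto (y - x) := by
  rw [radialProjection, smul_inv_smul₀ (norm_ne_zero_iff.2 h)]

/-- Projecting `y - x` to `K` costs `δ ε`; the projection has length between `(1 - δ) ε` and `ε`, so
stretching it to length `ε` costs at most another `δ ε`. -/
theorem norm_sub_smul_radialProjection_le (hδ : δ < 1) (hε : 0 < ε) (hy : ‖y - x‖ = ε)
    (h : ‖y - x - K.orthogonalProjectionOnto (y - x)‖ ≤ δ * ‖y - x‖) :
    ‖y - x - ε • (radialProjection K x y : E)‖ ≤ 2 * δ * ε := by
  have hl := one_sub_mul_le_norm_orthogonalProjectionOnto h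
  have hu := K.norm_orthogonalProjectionOnto_apply_le (y - x)
  rw [hy] at hl hu h
  have hpos : 0 < ‖K.orthogonalProjectionOnto (y - x)‖ :=
    lt_of_lt_of_le (mul_pos (by linarith) hε) hl
  have hne := norm_pos_iff.1 hpos
  have e : (K.orthogonalProjectionOnto (y - x) : E) - ε • (radialProjection K x y : E) =
      (‖K.orthogonalProjectionOnto (y - x)‖ - ε) • (radialProjection K x y : E) := by
    rw [sub_smul]
    congr 1
    exact (congrArg Subtype.val (norm_smul_radialProjection hne)).symm
  have h2 : ‖(K.orthogonalProjectionOnto (y - x) : E) - ε • (radialProjection K x y : E)‖ ≤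
      δ * ε := by
    rw [e, norm_smul, ← Submodule.coe_norm, norm_radialProjection hne, mul_one, Real.norm_eq_abs,
      abs_le]
    constructor <;> linarith
  calc _ ≤ _ := norm_sub_le_norm_sub_add_norm_sub _ (K.orthogonalProjectionOnto (y - x) : E) _
    _ ≤ 2 * δ * ε := by linarith

/-- On a sphere around `x`, radial projection is a similarity up to a factor close to `1` along
sets which are nearly parallel to `K`. -/
theorem dist_radialProjection_bounds (hδ0 : 0 ≤ δ) (hδ : δ < 1 / 2) (hε : 0 < ε)
    (hy : ‖y - x‖ = ε) (hz : ‖z - x‖ = ε)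
    (hyx : ‖y - x - K.orthogonalProjectionOnto (y - x)‖ ≤ δ * ‖y - x‖)
    (hzx : ‖z - x - K.orthogonalProjectionOnto (z - x)‖ ≤ δ * ‖z - x‖)
    (hyz : ‖y - z - K.orthogonalProjectionOnto (y - z)‖ ≤ δ * ‖y - z‖) :
    dist (radialProjection K x y) (radialProjection K x z) ≤ (1 - 2 * δ)⁻¹ * ε⁻¹ * dist y z ∧
      dist y z ≤ (1 - 2 * δ)⁻¹ * ε * dist (radialProjection K x y) (radialProjection K x z) := by
  have hly := one_sub_mul_le_norm_orthogonalProjectionOnto hyx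
  have hlz := one_sub_mul_le_norm_orthogonalProjectionOnto hzx
  have hlyz := one_sub_mul_le_norm_orthogonalProjectionOnto hyz
  have huy := K.norm_orthogonalProjectionOnto_apply_le (y - x)
  have huyz := K.norm_orthogonalProjectionOnto_apply_le (y - z)
  have sy := norm_sq_eq_orthogonalProjectionOnto_add (K := K) (y - x)
  have sz := norm_sq_eq_orthogonalProjectionOnto_add (K := K) (z - x)
  rw [hy] at hly huy sy hyx
  rw [hz] at hlz sz hzx
  have hpos : 0 < (1 - δ) * ε := mul_pos (by linarith) hε
  have hney := norm_pos_iff.1 (hpos.trans_le hly)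
  have hnez := norm_pos_iff.1 (hpos.trans_le hlz)
  have ny := norm_radialProjection hney
  have nz := norm_radialProjection hnez
  have ey := norm_smul_radialProjection hney
  have ez := norm_smul_radialProjection hnez
  have huv : K.orthogonalProjectionOnto (y - z) =
      K.orthogonalProjectionOnto (y - x) - K.orthogonalProjectionOnto (z - x) := by
    rw [← map_sub, sub_sub_sub_cancel_right]
  have hk : |‖y - x - K.orthogonalProjectionOnto (y - x)‖ -
      ‖z - x - K.orthogonalProjectionOnto (z - x)‖| ≤ δ * ‖y - z‖ := by
    refine (abs_norm_sub_norm_le _ _).trans (le_trans (le_of_eq ?_) hyz)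
    rw [huv, Submodule.coe_sub]
    congr 1
    abel
  rw [huv] at hlyz huyz
  rw [dist_eq_norm, dist_eq_norm]
  set u := K.orthogonalProjectionOnto (y - x)
  set v := K.orthogonalProjectionOnto (z - x)
  set p := radialProjection K x y
  set q := radialProjection K x z
  set k := ‖y - x - (u : E)‖
  set l := ‖z - x - (v : E)‖
  set D := ‖y - z‖
  have hk0 : 0 ≤ k := norm_nonneg _
  have hl0 : 0 ≤ l := norm_nonneg _
  have hD0 : 0 ≤ D := norm_nonneg _
  -- Both points lie at distance `ε` from `x`, so by Pythagoras `‖v‖² - ‖u‖² = k² - l²`. Here `|k -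
  -- l| ≤ δ D`, while `k + l ≤ 2 δ ε` is at most `2 (1 - δ) ε ≤ ‖u‖ + ‖v‖`.
  have hdiff : |‖v‖ - ‖u‖| ≤ δ * D := by
    have e : |‖v‖ - ‖u‖| * (‖u‖ + ‖v‖) = |k - l| * (k + l) := by
      rw [← abs_of_nonneg (add_nonneg (norm_nonneg u) (norm_nonneg v)),
        ← abs_of_nonneg (add_nonneg hk0 hl0), ← abs_mul, ← abs_mul]
      congr 1
      linarith
    have h1 : |‖v‖ - ‖u‖| * ((1 - δ) * ε + (1 - δ) * ε) ≤ δ * D * (δ * ε + δ * ε) :=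
      calc _ ≤ |‖v‖ - ‖u‖| * (‖u‖ + ‖v‖) := by gcongr
        _ = |k - l| * (k + l) := e
        _ ≤ _ := by gcongr
    have h2 : δ * D * (δ * ε + δ * ε) ≤ δ * D * ((1 - δ) * ε + (1 - δ) * ε) := by
      gcongr <;> linarith
    exact le_of_mul_le_mul_right (h1.trans h2) (by linarith)
  have e : ‖u‖ • (p - q) = (u - v) + (‖v‖ - ‖u‖) • q := by
    rw [smul_sub, sub_smul, ey, ez]; abel
  have en : ‖(‖v‖ - ‖u‖) • q‖ ≤ δ * D := by
    rw [norm_smul, nz, mul_one]; exact hdiff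
  have eu : ‖u‖ * ‖p - q‖ = ‖(u - v) + (‖v‖ - ‖u‖) • q‖ := by
    rw [← e, norm_smul, norm_norm]
  have hup : ‖u‖ * ‖p - q‖ ≤ (1 + δ) * D := by
    rw [eu]
    linarith [norm_add_le (u - v) ((‖v‖ - ‖u‖) • q)]
  have hlo : (1 - 2 * δ) * D ≤ ‖u‖ * ‖p - q‖ := by
    rw [eu]
    linarith [norm_sub_le_norm_add (u - v) ((‖v‖ - ‖u‖) • q)]
  have hc : 0 < 1 - 2 * δ := by linarith
  constructor
  · have h1 : (1 - δ) * (ε * ‖p - q‖) ≤ (1 + δ) * D :=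
      calc _ = (1 - δ) * ε * ‖p - q‖ := by ring
        _ ≤ ‖u‖ * ‖p - q‖ := by gcongr
        _ ≤ _ := hup
    -- Uses `(1 + δ) (1 - 2 δ) = 1 - δ - 2 δ² ≤ 1 - δ`.
    have h2 : (1 - δ) * ((1 - 2 * δ) * (ε * ‖p - q‖)) ≤ (1 - δ) * D := by
      have := mul_le_mul_of_nonneg_left h1 hc.le
      have h3 : 0 ≤ δ ^ 2 * D := by positivity
      nlinarith
    have h3 := le_of_mul_le_mul_left h2 (by linarith)
    rw [← mul_inv, inv_mul_eq_div, le_div_iff₀ (mul_pos hc hε)]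
    linarith
  · rw [mul_assoc, inv_mul_eq_div, le_div_iff₀ hc, mul_comm D]
    exact hlo.trans (by gcongr)

theorem sub_orthogonalProjectionOnto_orthogonal_span_singleton {n : E} (v : E) :
    ‖v - ((ℝ ∙ n)ᗮ.orthogonalProjectionOnto v : E)‖ = ‖n‖⁻¹ * |inner ℝ n v| := by
  have h : v - (ℝ ∙ n)ᗮ.orthogonalProjectionOnto v = (ℝ ∙ n).starProjection v := by
    rw [sub_eq_iff_eq_add]
    exact ((ℝ ∙ n).starProjection_add_starProjection_orthogonal v).symm
  rw [h, Submodule.starProjection_singleton, norm_smul]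
  rcases eq_or_ne n 0 with rfl | hn
  · simp
  · have : ‖n‖ ≠ 0 := norm_ne_zero_iff.2 hn
    simp only [RCLike.ofReal_real_eq_id, id, norm_div, norm_pow, Real.norm_eq_abs, abs_norm]
    field_simp

/-- The zero set of a function is nearly parallel to the kernel of its strict derivative. -/
theorem eventually_norm_sub_orthogonalProjectionOnto_le {φ : E → ℝ} {n : E}
    (hφ : HasStrictFDerivAt φ (innerSL ℝ n) x) (hn : n ≠ 0) (hδ : 0 < δ) :
    ∀ᶠ p in 𝓝 (x, x), φ p.1 = φ p.2 →
      ‖p.1 - p.2 - ((ℝ ∙ n)ᗮ.orthogonalProjectionOnto (p.1 - p.2) : E)‖ ≤ δ * ‖p.1 - p.2‖ := by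
  have hn' : 0 < ‖n‖ := norm_pos_iff.2 hn
  filter_upwards [hφ.isLittleO.def (mul_pos hδ hn')] with p hp hpp
  rw [hpp, sub_self, zero_sub, norm_neg, innerSL_apply_apply, Real.norm_eq_abs] at hp
  rw [sub_orthogonalProjectionOnto_orthogonal_span_singleton, inv_mul_le_iff₀ hn']
  linarith

/-- In every direction orthogonal to the gradient of `φ` and at every small distance from `x`
there is a zero of `φ`. -/
theorem eventually_exists_radialProjection_eq {φ : E → ℝ} {n : E}
    (hφ : HasFDerivAt φ (innerSL ℝ n) x) (hn : n ≠ 0) (hx : φ x = 0)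
    (hc : ∀ᶠ y in 𝓝 x, ContinuousAt φ y) :
    ∀ᶠ ε in 𝓝[>] (0 : ℝ), ∀ Y : (ℝ ∙ n)ᗮ, ‖Y‖ = 1 →
      ∃ y, ‖y - x‖ = ε ∧ φ y = 0 ∧ radialProjection (ℝ ∙ n)ᗮ x y = Y := by
  have hn' : 0 < ‖n‖ := norm_pos_iff.2 hn
  obtain ⟨r, hr, hball⟩ := Metric.eventually_nhds_iff.1
    (hc.and (hφ.isLittleO.def (half_pos hn')))
  filter_upwards [Ioo_mem_nhdsGT hr] with ε hε Y hY
  obtain ⟨hε0, hεr⟩ := hε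
  set ν : E := ‖n‖⁻¹ • n
  have hν : ‖ν‖ = 1 := by
    rw [norm_smul, norm_inv, norm_norm, inv_mul_cancel₀ hn'.ne']
  have hnν : inner ℝ n ν = ‖n‖ := by
    rw [inner_smul_right, real_inner_self_eq_norm_sq]; field_simp
  have hnY : inner ℝ n (Y : E) = 0 :=
    Submodule.inner_right_of_mem_orthogonal (Submodule.mem_span_singleton_self n) Y.2
  have hYν : inner ℝ (Y : E) ν = 0 := by
    rw [inner_smul_right, real_inner_comm, hnY, mul_zero]
  -- A half circle of radius `ε` from `-ν` through `Y` to `ν`. Along it `φ` is `ε ‖n‖ sin t` up to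
  -- `ε ‖n‖ / 2`, so it changes sign; at an interior zero `cos t > 0`, so the projection is a
  -- positive multiple of `Y`.
  let c : ℝ → E := fun t => x + ε • (Real.cos t • (Y : E) + Real.sin t • ν)
  have hcx : ∀ t, c t - x = ε • (Real.cos t • (Y : E) + Real.sin t • ν) := fun t =>
    add_sub_cancel_left _ _
  have hcn : ∀ t, ‖c t - x‖ = ε := by
    intro t
    have : ‖Real.cos t • (Y : E) + Real.sin t • ν‖ = 1 := by
      rw [← sq_eq_sq₀ (norm_nonneg _) zero_le_one, norm_add_sq_real, inner_smul_left,
        inner_smul_right, hYν, norm_smul, norm_smul, hν, ← Submodule.coe_norm, hY]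
      simp
    rw [hcx, norm_smul, this, Real.norm_of_nonneg hε0.le, mul_one]
  have hcball : ∀ t, dist (c t) x < r := fun t => by rw [dist_eq_norm, hcn]; exact hεr
  have hcont : Continuous (φ ∘ c) := by
    rw [continuous_iff_continuousAt]
    intro t
    refine ContinuousAt.comp (hball (hcball t)).1 ?_
    fun_prop
  have hval : ∀ t, |φ (c t) - ε * (Real.sin t * ‖n‖)| ≤ ‖n‖ / 2 * ε := by
    intro t
    have := (hball (hcball t)).2
    rwa [hx, sub_zero, hcn, innerSL_apply_apply, hcx, inner_smul_right, inner_add_right,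
      inner_smul_right, inner_smul_right, hnY, hnν, mul_zero, zero_add] at this
  have hpos : 0 < ‖n‖ / 2 * ε := by positivity
  have hup : 0 < φ (c (Real.pi / 2)) := by
    have := (abs_le.1 (hval (Real.pi / 2))).1
    rw [Real.sin_pi_div_two] at this
    linarith
  have hlo : φ (c (-(Real.pi / 2))) < 0 := by
    have := (abs_le.1 (hval (-(Real.pi / 2)))).2
    rw [Real.sin_neg, Real.sin_pi_div_two] at this
    linarith
  obtain ⟨t, ht, hφt⟩ := intermediate_value_Ioo (by linarith [Real.pi_pos])
    hcont.continuousOn (show (0 : ℝ) ∈ Set.Ioo ((φ ∘ c) (-(Real.pi / 2))) ((φ ∘ c) (Real.pi / 2))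
      from ⟨hlo, hup⟩)
  refine ⟨c t, hcn t, hφt, ?_⟩
  have hcos := Real.cos_pos_of_mem_Ioo ht
  have hproj : (ℝ ∙ n)ᗮ.orthogonalProjectionOnto (c t - x) = (ε * Real.cos t) • Y := by
    have h0 : (ℝ ∙ n)ᗮ.orthogonalProjectionOnto ν = 0 := by
      rw [Submodule.orthogonalProjectionOnto_eq_zero_iff, Submodule.orthogonal_orthogonal]
      exact Submodule.smul_mem _ _ (Submodule.mem_span_singleton_self n)
    rw [hcx, map_smul, map_add, map_smul, map_smul, h0, smul_zero, add_zero, smul_smul,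
      Submodule.orthogonalProjectionOnto_mem_subspace_eq_self]
  have hp : 0 < ε * Real.cos t := mul_pos hε0 hcos
  rw [radialProjection, hproj, norm_smul, hY, mul_one, Real.norm_of_nonneg hp.le,
    inv_smul_smul₀ hp.ne']

end RadialProjection

/-! ### Means over small spheres in a level set -/

section LevelSets

variable {n : ℕ} {M : Set (EuclideanSpace ℝ (Fin n))} {x : EuclideanSpace ℝ (Fin n)}

theorem eventually_forall_mem_smallSphere {p : EuclideanSpace ℝ (Fin n) → Prop}
    (h : ∀ᶠ y in 𝓝[M \ {x}] x, p y) :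
    ∀ᶠ ε in 𝓝[>] (0 : ℝ), ∀ y ∈ smallSphere M x ε, p y := by
  obtain ⟨r, hr, hball⟩ := Metric.eventually_nhds_iff.1 (eventually_nhdsWithin_iff.1 h)
  filter_upwards [Ioo_mem_nhdsGT hr] with ε hε y hy
  refine hball ?_ ⟨hy.1, ?_⟩
  · rw [dist_comm, dist_eq_norm, hy.2]; exact hε.2
  · rintro rfl
    have := hy.2
    rw [sub_self, norm_zero] at this
    exact hε.1.ne this

/-- `M` need not be closed, but for small `ε` the whole sphere around `x` lies where `φ` is
continuous and cuts out `M`, so `A_ε` is closed. -/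
theorem eventually_measurableSet_smallSphere {φ : EuclideanSpace ℝ (Fin n) → ℝ}
    (hc : ∀ᶠ y in 𝓝 x, ContinuousAt φ y) (hM : ∀ᶠ y in 𝓝 x, y ∈ M ↔ φ y = 0) :
    ∀ᶠ ε in 𝓝[>] (0 : ℝ), MeasurableSet (smallSphere M x ε) := by
  obtain ⟨r, hr, hball⟩ := Metric.eventually_nhds_iff.1 (hc.and hM)
  filter_upwards [Ioo_mem_nhdsGT hr] with ε hε
  have hlt : ∀ y ∈ Metric.sphere x ε, dist y x < r := fun y hy => by
    rw [Metric.mem_sphere.1 hy]; exact hε.2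
  have e : smallSphere M x ε = Metric.sphere x ε ∩ φ ⁻¹' {0} := by
    ext y
    constructor
    · rintro ⟨hy, hyε⟩
      have hs : y ∈ Metric.sphere x ε := by rw [Metric.mem_sphere, dist_comm, dist_eq_norm, hyε]
      exact ⟨hs, (hball (hlt y hs)).2.1 hy⟩
    · rintro ⟨hs, hy⟩
      refine ⟨(hball (hlt y hs)).2.2 hy, ?_⟩
      rwa [Metric.mem_sphere, dist_comm, dist_eq_norm] at hs
  rw [e]
  exact (ContinuousOn.preimage_isClosed_of_isClosed
    (fun y hy => (hball (hlt y hy)).1.continuousWithinAt) Metric.isClosed_sphere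
    isClosed_singleton).measurableSet

variable {φ f : EuclideanSpace ℝ (Fin n) → ℝ} {g : EuclideanSpace ℝ (Fin n)}
  {K : Submodule ℝ (EuclideanSpace ℝ (Fin n))}
  {T : EuclideanSpace ℝ (Fin n) →L[ℝ] EuclideanSpace ℝ (Fin n)}

/-- Averages over small spheres in the level set of `φ` are close to averages over the unit sphere
of the kernel of the derivative of `φ`. -/
theorem eventually_abs_setAverage_smallSphere_sub_le
    (hφ : HasStrictFDerivAt φ (innerSL ℝ g) x) (hg : g ≠ 0)
    (hc : ∀ᶠ y in 𝓝 x, ContinuousAt φ y) (hM : ∀ᶠ y in 𝓝 x, y ∈ M ↔ φ y = 0) (hx : x ∈ M)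
    (hK : K = (ℝ ∙ g)ᗮ) (hK1 : 1 ≤ Module.finrank ℝ K)
    (hfc : ∀ᶠ y in 𝓝[M \ {x}] x, ContinuousWithinAt f M y)
    (hf : ∀ η > 0, ∀ᶠ y in 𝓝[M \ {x}] x, |f y - ‖T (‖y - x‖⁻¹ • (y - x))‖| ≤ η)
    {δ : ℝ} (hδ0 : 0 < δ) (hδ : δ < 1 / 2) :
    ∀ᶠ ε in 𝓝[>] (0 : ℝ), MeasurableSet (smallSphere M x ε) ∧
      0 < μHE[Module.finrank ℝ K - 1] (smallSphere M x ε) ∧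
      μHE[Module.finrank ℝ K - 1] (smallSphere M x ε) < ⊤ ∧
      IntegrableOn f (smallSphere M x ε) μHE[Module.finrank ℝ K - 1] ∧
      |⨍ y in smallSphere M x ε, f y ∂μHE[Module.finrank ℝ K - 1] -
        ⨍ Y in Metric.sphere (0 : K) 1, ‖T Y‖ ∂μHE[Module.finrank ℝ K - 1]| ≤
        δ + ‖T‖ * (2 * δ) + (((1 - 2 * δ)⁻¹ * (1 - 2 * δ)⁻¹) ^ (Module.finrank ℝ K - 1) - 1) *
          ⨍ Y in Metric.sphere (0 : K) 1, ‖T Y‖ ∂μHE[Module.finrank ℝ K - 1] := by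
  have hφx : φ x = 0 := hM.self_of_nhds.1 hx
  -- Both endpoints of the chord vary, which is why the derivative of `φ` at `x` has to be strict.
  obtain ⟨r, hr, hflat⟩ : ∃ r > 0, ∀ y ∈ Metric.ball x r, ∀ z ∈ Metric.ball x r, y ∈ M → z ∈ M →
      ‖y - z - (K.orthogonalProjectionOnto (y - z) : EuclideanSpace ℝ (Fin n))‖ ≤
        δ * ‖y - z‖ := by
    subst hK
    have h1 := eventually_norm_sub_orthogonalProjectionOnto_le hφ hg hδ0
    have h2 : ∀ᶠ p in 𝓝 (x, x), (p.1 ∈ M ↔ φ p.1 = 0) ∧ (p.2 ∈ M ↔ φ p.2 = 0) :=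
      hM.prod_nhds hM
    rw [nhds_prod_eq] at h1 h2
    obtain ⟨s, hs, hs'⟩ := Filter.mem_prod_same_iff.1 (h1.and h2)
    obtain ⟨r, hr, hrs⟩ := Metric.mem_nhds_iff.1 hs
    refine ⟨r, hr, fun y hy z hz hyM hzM => ?_⟩
    obtain ⟨q1, q2, q3⟩ := hs' (Set.mk_mem_prod (hrs hy) (hrs hz))
    exact q1 ((q2.1 hyM).trans (q3.1 hzM).symm)
  have hex : ∀ᶠ ε in 𝓝[>] (0 : ℝ), ∀ Y : K, ‖Y‖ = 1 →
      ∃ y, ‖y - x‖ = ε ∧ φ y = 0 ∧ radialProjection K x y = Y := by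
    subst hK
    exact eventually_exists_radialProjection_eq hφ.hasFDerivAt hg hφx hc
  obtain ⟨ρ, hρ, hMρ⟩ := Metric.eventually_nhds_iff.1 hM
  filter_upwards [hex, eventually_measurableSet_smallSphere hc hM, self_mem_nhdsWithin,
    Ioo_mem_nhdsGT hr, Ioo_mem_nhdsGT hρ, eventually_forall_mem_smallSphere hfc,
    eventually_forall_mem_smallSphere (hf δ hδ0)] with ε hex hmeas hε hεr hερ hfc hf
  have hε : 0 < ε := hε
  have hnorm : ∀ y ∈ smallSphere M x ε, ‖y - x‖ = ε := fun y hy => by rw [norm_sub_rev]; exact hy.2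
  have hball : ∀ y ∈ smallSphere M x ε, y ∈ Metric.ball x r := fun y hy => by
    rw [Metric.mem_ball, dist_eq_norm, hnorm y hy]; exact hεr.2
  have hyx := fun y hy => hflat y (hball y hy) x (Metric.mem_ball_self hr) hy.1 hx
  have hbd := fun y (hy : y ∈ smallSphere M x ε) z (hz : z ∈ smallSphere M x ε) =>
    dist_radialProjection_bounds hδ0.le hδ hε (hnorm y hy) (hnorm z hz) (hyx y hy) (hyx z hz)
      (hflat y (hball y hy) z (hball z hz) hy.1 hz.1)
  have hC : 0 < (1 - 2 * δ)⁻¹ := inv_pos.2 (by linarith)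
  have hC1 : 1 ≤ (1 - 2 * δ)⁻¹ := (one_le_inv₀ (by linarith)).2 (by linarith)
  have hPA : radialProjection K x '' smallSphere M x ε = Metric.sphere (0 : K) 1 := by
    apply Set.Subset.antisymm
    · rintro _ ⟨y, hy, rfl⟩
      rw [mem_sphere_zero_iff_norm]
      refine norm_radialProjection (norm_pos_iff.1 (lt_of_lt_of_le ?_
        (one_sub_mul_le_norm_orthogonalProjectionOnto (hyx y hy))))
      rw [hnorm y hy]
      exact mul_pos (by linarith) hε
    · intro Y hY
      obtain ⟨y, hy, hφy, rfl⟩ := hex Y (mem_sphere_zero_iff_norm.1 hY)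
      refine ⟨y, ⟨(hMρ ?_).2 hφy, by rw [norm_sub_rev, hy]⟩, rfl⟩
      rw [dist_eq_norm, hy]; exact hερ.2
  -- The powers of `ε` cancel in `a * b`.
  let a : NNReal := ⟨(1 - 2 * δ)⁻¹ * ε, by positivity⟩
  let b : NNReal := ⟨(1 - 2 * δ)⁻¹ * ε⁻¹, by positivity⟩
  have habr : (a : ℝ) * b = (1 - 2 * δ)⁻¹ * (1 - 2 * δ)⁻¹ := by
    change (1 - 2 * δ)⁻¹ * ε * ((1 - 2 * δ)⁻¹ * ε⁻¹) = _
    rw [mul_mul_mul_comm, mul_inv_cancel₀ hε.ne', mul_one]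
  have hab : 1 ≤ a * b := by
    rw [← NNReal.coe_le_coe, NNReal.coe_mul, habr, NNReal.coe_one]
    nlinarith
  obtain ⟨k1, k2, k3⟩ := abs_setAverage_sub_setAverage_le hmeas
    (euclideanHausdorffMeasure_sphere_pos hK1) (euclideanHausdorffMeasure_sphere_lt_top hK1)
    (measurable_radialProjection (K := K) (x := x)) hPA hab
    (LipschitzOnWith.of_dist_le_mul fun y hy z hz => (hbd y hy z hz).1)
    (fun y hy z hz => (hbd y hy z hz).2)
  have hfm : AEStronglyMeasurable f
      (μHE[Module.finrank ℝ K - 1].restrict (smallSphere M x ε)) :=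
    ContinuousOn.aestronglyMeasurable
      (fun y hy => (hfc y hy).mono fun z hz => hz.1) hmeas
  have hTint : IntegrableOn (fun Y : K => ‖T Y‖) (Metric.sphere (0 : K) 1)
      μHE[Module.finrank ℝ K - 1] := by
    have hcont : Continuous fun Y : K => ‖T Y‖ := by fun_prop
    have : IsFiniteMeasure
        (μHE[Module.finrank ℝ K - 1].restrict (Metric.sphere (0 : K) 1)) :=
      ⟨by simpa using euclideanHausdorffMeasure_sphere_lt_top hK1⟩
    refine Integrable.of_bound hcont.aestronglyMeasurable ‖T‖
      ((ae_restrict_iff' Metric.isClosed_sphere.measurableSet).2 (Eventually.of_forall ?_))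
    intro Y hY
    have := T.le_opNorm (Y : EuclideanSpace ℝ (Fin n))
    rwa [← Submodule.coe_norm, mem_sphere_zero_iff_norm.1 hY, mul_one, ← norm_norm] at this
  -- The term `δ` comes from `hf`, the other from replacing `(y - x) / ε` by the radial projection.
  have hfP : ∀ y ∈ smallSphere M x ε,
      |f y - ‖T (radialProjection K x y : EuclideanSpace ℝ (Fin n))‖| ≤ δ + ‖T‖ * (2 * δ) := by
    intro y hy
    have h1 := hf y hy
    have h2 := norm_sub_smul_radialProjection_le (by linarith) hε (hnorm y hy) (hyx y hy)
    rw [hnorm y hy] at h1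
    have h3 : ‖ε⁻¹ • (y - x) - (radialProjection K x y : EuclideanSpace ℝ (Fin n))‖ ≤ 2 * δ := by
      have e : ε⁻¹ • (y - x) - (radialProjection K x y : EuclideanSpace ℝ (Fin n)) =
          ε⁻¹ • (y - x - ε • (radialProjection K x y : EuclideanSpace ℝ (Fin n))) := by
        rw [smul_sub ε⁻¹ (y - x), inv_smul_smul₀ hε.ne']
      rw [e, norm_smul, norm_inv, Real.norm_of_nonneg hε.le, inv_mul_le_iff₀ hε]
      linarith
    have h4 : |‖T (ε⁻¹ • (y - x))‖ - ‖T (radialProjection K x y : EuclideanSpace ℝ (Fin n))‖| ≤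
        ‖T‖ * (2 * δ) := by
      refine (abs_norm_sub_norm_le _ _).trans ?_
      rw [← map_sub]
      exact (T.le_opNorm _).trans (mul_le_mul_of_nonneg_left h3 (norm_nonneg _))
    exact (abs_sub_le _ _ _).trans (add_le_add h1 h4)
  obtain ⟨k4, k5⟩ := k3 hfm hTint (fun _ => norm_nonneg _) hfP
  rw [habr] at k5
  exact ⟨hmeas, k1, k2, k4, k5⟩

theorem tendsto_setAverage_smallSphere
    (hφ : HasStrictFDerivAt φ (innerSL ℝ g) x) (hg : g ≠ 0)
    (hc : ∀ᶠ y in 𝓝 x, ContinuousAt φ y) (hM : ∀ᶠ y in 𝓝 x, y ∈ M ↔ φ y = 0) (hx : x ∈ M)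
    (hK : K = (ℝ ∙ g)ᗮ) (hK1 : 1 ≤ Module.finrank ℝ K)
    (hfc : ∀ᶠ y in 𝓝[M \ {x}] x, ContinuousWithinAt f M y)
    (hf : ∀ η > 0, ∀ᶠ y in 𝓝[M \ {x}] x, |f y - ‖T (‖y - x‖⁻¹ • (y - x))‖| ≤ η) :
    Tendsto (fun ε => ⨍ y in smallSphere M x ε, f y ∂μHE[Module.finrank ℝ K - 1]) (𝓝[>] 0)
      (𝓝 (⨍ Y in Metric.sphere (0 : K) 1, ‖T Y‖ ∂μHE[Module.finrank ℝ K - 1])) := by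
  rw [Metric.tendsto_nhds]
  intro e he
  set I := ⨍ Y in Metric.sphere (0 : K) 1, ‖T Y‖ ∂μHE[Module.finrank ℝ K - 1]
  have hlim : Tendsto (fun δ : ℝ => δ + ‖T‖ * (2 * δ) +
      (((1 - 2 * δ)⁻¹ * (1 - 2 * δ)⁻¹) ^ (Module.finrank ℝ K - 1) - 1) * I) (𝓝[>] 0) (𝓝 0) := by
    have hcont : ContinuousAt (fun δ : ℝ => δ + ‖T‖ * (2 * δ) +
        (((1 - 2 * δ)⁻¹ * (1 - 2 * δ)⁻¹) ^ (Module.finrank ℝ K - 1) - 1) * I) 0 := by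
      have : ContinuousAt (fun δ : ℝ => (1 - 2 * δ)⁻¹) 0 :=
        ContinuousAt.inv₀ (by fun_prop) (by norm_num)
      fun_prop
    have := hcont.tendsto
    simp only [mul_zero, sub_zero, inv_one, mul_one, one_pow, sub_self, zero_mul, add_zero] at this
    exact this.mono_left nhdsWithin_le_nhds
  obtain ⟨δ, hδe, hδ0, hδ⟩ := ((hlim.eventually_lt_const he).and
    (Ioo_mem_nhdsGT (show (0 : ℝ) < 1 / 2 by norm_num))).exists
  filter_upwards [eventually_abs_setAverage_smallSphere_sub_le hφ hg hc hM hx hK hK1 hfc hf hδ0 hδ]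
    with ε hε
  rw [Real.dist_eq]
  exact hε.2.2.2.2.trans_lt hδe

end LevelSets

/-! ### Defining functions, unit normals and the angle of tangent spaces -/

section Hypersurface

theorem exists_eq_orthogonal_span_singleton {m : ℕ}
    {V : Submodule ℝ (EuclideanSpace ℝ (Fin (m + 1)))} (hV : Module.finrank ℝ V = m) :
    ∃ a : EuclideanSpace ℝ (Fin (m + 1)), a ≠ 0 ∧ V = (ℝ ∙ a)ᗮ := by
  have h1 : Module.finrank ℝ Vᗮ = 1 := by
    have := V.finrank_add_finrank_orthogonal
    rw [finrank_euclideanSpace_fin, hV] at this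
    omega
  obtain ⟨a, ha, hspan⟩ := finrank_eq_one_iff'.1 h1
  refine ⟨a, by simpa using ha, ?_⟩
  have : Vᗮ = ℝ ∙ (a : EuclideanSpace ℝ (Fin (m + 1))) := by
    apply le_antisymm
    · intro v hv
      obtain ⟨c, hc⟩ := hspan ⟨v, hv⟩
      exact Submodule.mem_span_singleton.2 ⟨c, congrArg Subtype.val hc⟩
    · exact (Submodule.span_singleton_le_iff_mem _ _).2 a.2
  rw [← this, Submodule.orthogonal_orthogonal]

theorem contDiffOn_exists_gradient {n : ℕ} {φ : EuclideanSpace ℝ (Fin n) → ℝ}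
    {W : Set (EuclideanSpace ℝ (Fin n))} (hW : IsOpen W) (hφ : ContDiffOn ℝ ∞ φ W) :
    ∃ G : EuclideanSpace ℝ (Fin n) → EuclideanSpace ℝ (Fin n), ContDiffOn ℝ ∞ G W ∧
      ∀ y, innerSL ℝ (G y) = fderiv ℝ φ y := by
  let b := EuclideanSpace.basisFun (Fin n) ℝ
  refine ⟨fun y => ∑ i, fderiv ℝ φ y (b i) • b i, ?_, fun y => ?_⟩
  · have h := hφ.fderiv_of_isOpen hW (m := ∞) (by simp)
    exact ContDiffOn.sum fun i _ => (h.clm_apply contDiffOn_const).smul contDiffOn_const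
  · ext w
    rw [innerSL_apply_apply, sum_inner]
    conv_rhs => rw [← b.sum_repr' w, map_sum]
    refine Finset.sum_congr rfl fun i _ => ?_
    rw [inner_smul_left, map_smul, smul_eq_mul, mul_comm]
    simp

variable {m : ℕ} {M : Set (EuclideanSpace ℝ (Fin (m + 1)))} {x : EuclideanSpace ℝ (Fin (m + 1))}

/-- A hypersurface is locally a regular level set, and its tangent spaces are the orthogonal
complements of the gradient. -/
theorem IsSmoothSubmanifold.exists_definingFunction (hM : IsSmoothSubmanifold m M) (hx : x ∈ M) :
    ∃ (W : Set (EuclideanSpace ℝ (Fin (m + 1)))) (φ : EuclideanSpace ℝ (Fin (m + 1)) → ℝ)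
      (G : EuclideanSpace ℝ (Fin (m + 1)) → EuclideanSpace ℝ (Fin (m + 1))),
      IsOpen W ∧ x ∈ W ∧ ContDiffOn ℝ ∞ G W ∧ ∀ y ∈ W, (y ∈ M ↔ φ y = 0) ∧
        HasStrictFDerivAt φ (innerSL ℝ (G y)) y ∧ G y ≠ 0 ∧
        (y ∈ M → tangentSpaceAt M y = (ℝ ∙ G y)ᗮ) := by
  obtain ⟨Φ, V, hxΦ, hΦ, hΨ, hV, hMV⟩ := hM x hx
  obtain ⟨a, ha, rfl⟩ := exists_eq_orthogonal_span_singleton hV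
  have hφ : ContDiffOn ℝ ∞ (fun y => innerSL ℝ a (Φ y)) Φ.source :=
    (innerSL ℝ a).contDiff.comp_contDiffOn hΦ
  obtain ⟨G, hG, hGφ⟩ := contDiffOn_exists_gradient Φ.open_source hφ
  have hmem : ∀ y ∈ Φ.source, y ∈ M ↔ innerSL ℝ a (Φ y) = 0 := fun y hy => by
    rw [hMV y hy, Submodule.mem_orthogonal_singleton_iff_inner_right, innerSL_apply_apply]
  refine ⟨Φ.source, fun y => innerSL ℝ a (Φ y), G, Φ.open_source, hxΦ, hG, fun y hy => ?_⟩
  have hdΦ : HasFDerivAt Φ (fderiv ℝ Φ y) y :=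
    ((hΦ.contDiffAt (Φ.open_source.mem_nhds hy)).differentiableAt (by simp)).hasFDerivAt
  have hdΨ : HasFDerivAt Φ.symm (fderiv ℝ Φ.symm (Φ y)) (Φ y) :=
    ((hΨ.contDiffAt (Φ.open_target.mem_nhds (Φ.map_source hy))).differentiableAt
      (by simp)).hasFDerivAt
  have hφy := (hφ.contDiffAt (Φ.open_source.mem_nhds hy)).hasStrictFDerivAt (by simp)
  rw [← hGφ] at hφy
  have hGin : ∀ w, inner ℝ (G y) w = inner ℝ a (fderiv ℝ Φ y w) := fun w =>
    congrArg (fun T : EuclideanSpace ℝ (Fin (m + 1)) →L[ℝ] ℝ => T w)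
      (hφy.hasFDerivAt.unique ((innerSL ℝ a).hasFDerivAt.comp y hdΦ))
  have hright : ∀ w, fderiv ℝ Φ y (fderiv ℝ Φ.symm (Φ y) w) = w := fun w => by
    have hdΦ' : HasFDerivAt Φ (fderiv ℝ Φ y) (Φ.symm (Φ y)) := by rwa [Φ.left_inv hy]
    have h1 : HasFDerivAt (Φ ∘ Φ.symm) (ContinuousLinearMap.id ℝ _) (Φ y) :=
      (hasFDerivAt_id _).congr_of_eventuallyEq
        ((Φ.eventually_right_inverse (Φ.map_source hy)).mono fun _ h => h)
    exact congrArg (fun T : EuclideanSpace ℝ (Fin (m + 1)) →L[ℝ] _ => T w)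
      ((hdΦ'.comp (Φ y) hdΨ).unique h1)
  have hleft : ∀ w, fderiv ℝ Φ.symm (Φ y) (fderiv ℝ Φ y w) = w := fun w => by
    have h1 : HasFDerivAt (Φ.symm ∘ Φ) (ContinuousLinearMap.id ℝ _) y :=
      (hasFDerivAt_id _).congr_of_eventuallyEq
        ((Φ.eventually_left_inverse hy).mono fun _ h => h)
    exact congrArg (fun T : EuclideanSpace ℝ (Fin (m + 1)) →L[ℝ] _ => T w)
      ((hdΨ.comp y hdΦ).unique h1)
  refine ⟨hmem y hy, hφy, ?_, fun hyM => le_antisymm ?_ ?_⟩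
  · intro h0
    -- On the vector that `dΦ` sends to `a`, the derivative of `φ` equals `‖a‖² ≠ 0`.
    have := hGin (fderiv ℝ Φ.symm (Φ y) a)
    rw [h0, inner_zero_left, hright] at this
    exact ha (inner_self_eq_zero.1 this.symm)
  · refine Submodule.span_le.2 ?_
    rintro v ⟨γ, hγ0, hγM, hγ⟩
    rw [SetLike.mem_coe, Submodule.mem_orthogonal_singleton_iff_inner_right]
    have hφγ : HasFDerivAt (fun z => innerSL ℝ a (Φ z)) (innerSL ℝ (G y)) (γ 0) := by
      rw [hγ0]; exact hφy.hasFDerivAt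
    have h1 := hφγ.comp_hasDerivAt (0 : ℝ) hγ
    have h2 : HasDerivAt ((fun z => innerSL ℝ a (Φ z)) ∘ γ) 0 0 := by
      refine (hasDerivAt_const (0 : ℝ) (0 : ℝ)).congr_of_eventuallyEq ?_
      have hsrc : ∀ᶠ t in 𝓝 (0 : ℝ), γ t ∈ Φ.source :=
        hγ.continuousAt.eventually (by rw [hγ0]; exact Φ.open_source.mem_nhds hy)
      filter_upwards [hγM, hsrc] with t ht hts
      exact (hmem _ hts).1 ht
    exact h1.unique h2
  · intro v hv
    rw [Submodule.mem_orthogonal_singleton_iff_inner_right, hGin] at hv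
    -- The straight line in the flattened picture stays in the linear subspace, since `hv` says that
    -- `dΦ v` lies in it.
    refine Submodule.subset_span ⟨fun t => Φ.symm (Φ y + t • fderiv ℝ Φ y v), ?_, ?_, ?_⟩
    · simp [Φ.left_inv hy]
    · have htgt : ∀ᶠ t in 𝓝 (0 : ℝ), Φ y + t • fderiv ℝ Φ y v ∈ Φ.target := by
        have hc : ContinuousAt (fun t : ℝ => Φ y + t • fderiv ℝ Φ y v) 0 := by fun_prop
        exact hc.eventually (by simpa using Φ.open_target.mem_nhds (Φ.map_source hy))
      filter_upwards [htgt] with t ht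
      rw [hmem _ (Φ.map_target ht), Φ.right_inv ht, map_add, map_smul, (hmem y hy).1 hyM,
        innerSL_apply_apply, hv]
      simp
    · have hl : HasDerivAt (fun t : ℝ => Φ y + t • fderiv ℝ Φ y v) (fderiv ℝ Φ y v) 0 := by
        simpa using ((hasDerivAt_id (0 : ℝ)).smul_const (fderiv ℝ Φ y v)).const_add (Φ y)
      have hdΨ' : HasFDerivAt Φ.symm (fderiv ℝ Φ.symm (Φ y))
          (Φ y + (0 : ℝ) • fderiv ℝ Φ y v) := by simpa using hdΨ
      have := hdΨ'.comp_hasDerivAt (0 : ℝ) hl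
      rwa [hleft] at this

theorem span_singleton_eq_of_mem_of_norm_eq_one {E : Type*} [NormedAddCommGroup E]
    [NormedSpace ℝ E] {a g : E} (ha : a ∈ ℝ ∙ g) (h1 : ‖a‖ = 1) : ℝ ∙ g = ℝ ∙ a := by
  obtain ⟨c, rfl⟩ := Submodule.mem_span_singleton.1 ha
  have hc : c ≠ 0 := by rintro rfl; simp at h1
  exact (Submodule.span_singleton_smul_eq (IsUnit.mk0 c hc) g).symm

/-- Normals are multiples of `a` and `b`, and `0 ≤ ⟪a, b⟫` says that this choice of signs attains
the minimal angle. The chord of two unit vectors at angle `θ` has length `2 sin (θ / 2)`. -/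
theorem two_mul_sin_hyperplaneAngle_half {n : ℕ} {V W : Submodule ℝ (EuclideanSpace ℝ (Fin n))}
    {a b : EuclideanSpace ℝ (Fin n)} (hV : Vᗮ = ℝ ∙ a) (hW : Wᗮ = ℝ ∙ b) (ha : ‖a‖ = 1)
    (hb : ‖b‖ = 1) (hab : 0 ≤ inner ℝ a b) :
    2 * Real.sin (hyperplaneAngle V W / 2) = ‖a - b‖ := by
  have hangle : hyperplaneAngle V W = InnerProductGeometry.angle a b := by
    refine IsLeast.csInf_eq ⟨⟨a, ?_, b, ?_, ?_, ?_, rfl⟩, ?_⟩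
    · rw [hV]; exact Submodule.mem_span_singleton_self a
    · rw [hW]; exact Submodule.mem_span_singleton_self b
    · rintro rfl; simp at ha
    · rintro rfl; simp at hb
    · rintro _ ⟨u, hu, v, hv, hu0, hv0, rfl⟩
      rw [hV] at hu
      rw [hW] at hv
      obtain ⟨s, rfl⟩ := Submodule.mem_span_singleton.1 hu
      obtain ⟨t, rfl⟩ := Submodule.mem_span_singleton.1 hv
      have hs : s ≠ 0 := by rintro rfl; simp at hu0
      have ht : t ≠ 0 := by rintro rfl; simp at hv0
      unfold InnerProductGeometry.angle
      apply Real.arccos_le_arccos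
      rw [norm_smul, norm_smul, ha, hb, inner_smul_left, inner_smul_right, mul_one, mul_one,
        mul_one, div_one, Real.norm_eq_abs, Real.norm_eq_abs, ← abs_mul,
        div_le_iff₀ (abs_pos.2 (mul_ne_zero hs ht)), mul_comm (inner ℝ a b), ← mul_assoc]
      exact mul_le_mul_of_nonneg_right (le_abs_self _) hab
  have hsin : 0 ≤ Real.sin (InnerProductGeometry.angle a b / 2) :=
    Real.sin_nonneg_of_nonneg_of_le_pi
      (by linarith [InnerProductGeometry.angle_nonneg a b])
      (by linarith [InnerProductGeometry.angle_le_pi a b, Real.pi_pos])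
  have hcos : Real.cos (InnerProductGeometry.angle a b) = inner ℝ a b := by
    rw [InnerProductGeometry.cos_angle, ha, hb]; simp
  have hdouble : Real.cos (InnerProductGeometry.angle a b) =
      1 - 2 * Real.sin (InnerProductGeometry.angle a b / 2) ^ 2 := by
    have h := Real.cos_two_mul (InnerProductGeometry.angle a b / 2)
    rw [mul_div_cancel₀ _ two_ne_zero] at h
    rw [h, Real.cos_sq']; ring
  rw [hangle, ← sq_eq_sq₀ (by positivity) (norm_nonneg _), norm_sub_sq_real, ha, hb, ← hcos,
    hdouble]
  ring

theorem IsSmoothSubmanifold.exists_isUnitNormalNear (hM : IsSmoothSubmanifold m M) (hx : x ∈ M) :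
    ∃ N, IsUnitNormalNear M x N := by
  obtain ⟨W, φ, G, hW, hxW, hG, h⟩ := hM.exists_definingFunction hx
  refine ⟨fun y => ‖G y‖⁻¹ • G y, W, hW.mem_nhds hxW, ?_, ?_⟩
  · have h1 : ContDiffOn ℝ ∞ (fun y => ‖G y‖⁻¹) W :=
      (hG.norm ℝ fun y hy => (h y hy).2.2.1).inv fun y hy => norm_ne_zero_iff.2 (h y hy).2.2.1
    exact (h1.smul hG).mono Set.inter_subset_right
  · rintro y ⟨hyM, hyW⟩
    obtain ⟨-, -, hne, hT⟩ := h y hyW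
    refine ⟨?_, ?_⟩
    · rw [norm_smul, norm_inv, norm_norm, inv_mul_cancel₀ (norm_ne_zero_iff.2 hne)]
    · rw [hT hyM, Submodule.orthogonal_orthogonal]
      exact Submodule.smul_mem _ _ (Submodule.mem_span_singleton_self _)

theorem IsUnitNormalNear.eventually_continuousWithinAt
    {N : EuclideanSpace ℝ (Fin (m + 1)) → EuclideanSpace ℝ (Fin (m + 1))}
    (hN : IsUnitNormalNear M x N) : ∀ᶠ y in 𝓝[M] x, ContinuousWithinAt N M y := by
  obtain ⟨U, hU, hNU, -⟩ := hN
  filter_upwards [self_mem_nhdsWithin, nhdsWithin_le_nhds (eventually_mem_nhds_iff.2 hU)]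
    with y hy hyU
  exact (continuousWithinAt_inter hyU).1 (hNU.continuousOn y ⟨hy, mem_of_mem_nhds hyU⟩)

theorem IsUnitNormalNear.differentiableWithinAt
    {N : EuclideanSpace ℝ (Fin (m + 1)) → EuclideanSpace ℝ (Fin (m + 1))}
    (hN : IsUnitNormalNear M x N) (hx : x ∈ M) : DifferentiableWithinAt ℝ N M x := by
  obtain ⟨U, hU, hNU, -⟩ := hN
  exact (differentiableWithinAt_inter hU).1
    ((hNU x ⟨hx, mem_of_mem_nhds hU⟩).differentiableWithinAt (by simp))

theorem IsUnitNormalNear.eventually_discreteVariationCurvature_eq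
    {N : EuclideanSpace ℝ (Fin (m + 1)) → EuclideanSpace ℝ (Fin (m + 1))}
    (hN : IsUnitNormalNear M x N) (hM : IsSmoothSubmanifold m M) (hx : x ∈ M) :
    ∀ᶠ y in 𝓝[M \ {x}] x, discreteVariationCurvature M x y = ‖N x - N y‖ / ‖x - y‖ := by
  obtain ⟨W, φ, G, hW, hxW, hG, h⟩ := hM.exists_definingFunction hx
  have hcont : ContinuousWithinAt N M x :=
    hN.eventually_continuousWithinAt.self_of_nhdsWithin hx
  obtain ⟨U, hU, hNU, hunit⟩ := hN
  have hspan : ∀ y ∈ M, y ∈ W → y ∈ U → (tangentSpaceAt M y)ᗮ = ℝ ∙ N y := by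
    intro y hyM hyW hyU
    obtain ⟨h1, h2⟩ := hunit y ⟨hyM, hyU⟩
    rw [(h y hyW).2.2.2 hyM, Submodule.orthogonal_orthogonal] at h2 ⊢
    exact span_singleton_eq_of_mem_of_norm_eq_one h2 h1
  have hxU := mem_of_mem_nhds hU
  have hpos : ∀ᶠ y in 𝓝[M] x, 0 < inner ℝ (N x) (N y) := by
    have : Tendsto (fun y => inner ℝ (N x) (N y)) (𝓝[M] x) (𝓝 (inner ℝ (N x) (N x))) :=
      tendsto_const_nhds.inner hcont
    refine this.eventually_const_lt ?_
    rw [real_inner_self_eq_norm_sq, (hunit x ⟨hx, hxU⟩).1]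
    norm_num
  filter_upwards [nhdsWithin_mono x Set.sdiff_subset hpos, self_mem_nhdsWithin,
    nhdsWithin_le_nhds (hW.mem_nhds hxW), nhdsWithin_le_nhds hU] with y hy hyM hyW hyU
  rw [discreteVariationCurvature, two_mul_sin_hyperplaneAngle_half (hspan x hx hxW hxU)
    (hspan y hyM.1 hyW hyU) (hunit x ⟨hx, hxU⟩).1 (hunit y ⟨hyM.1, hyU⟩).1 hy.le]

/-- First-order expansion of `N`. Here `T` acts on the whole space because `y - x` is only
approximately tangent; the sign of `-T` matches the shape operator. -/
theorem abs_norm_sub_div_norm_sub_sub_le {E F : Type*} [NormedAddCommGroup E] [NormedSpace ℝ E]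
    [NormedAddCommGroup F] [NormedSpace ℝ F] {N : E → F} {T : E →L[ℝ] F} {s : Set E} {x : E}
    (h : HasFDerivWithinAt N T s x) {η : ℝ} (hη : 0 < η) :
    ∀ᶠ y in 𝓝[s \ {x}] x,
      |‖N x - N y‖ / ‖x - y‖ - ‖(-T) (‖y - x‖⁻¹ • (y - x))‖| ≤ η := by
  filter_upwards [nhdsWithin_mono x Set.sdiff_subset (h.isLittleO.def hη), self_mem_nhdsWithin]
    with y hy hys
  have hpos : 0 < ‖y - x‖ := norm_pos_iff.2 (sub_ne_zero.2 hys.2)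
  rw [neg_apply, norm_neg, map_smul, norm_smul, norm_inv, norm_norm,
    norm_sub_rev x y, norm_sub_rev (N x), div_eq_inv_mul, ← mul_sub, abs_mul,
    abs_of_pos (inv_pos.2 hpos), inv_mul_le_iff₀ hpos, mul_comm]
  exact (abs_norm_sub_norm_le _ _).trans hy

end Hypersurface

/-! ### The absolute variation curvature -/

theorem mainTheorem5 (m : ℕ) (hm : 1 ≤ m) (M : Set (EuclideanSpace ℝ (Fin (m + 1))))
    (hM : IsSmoothSubmanifold m M) (x : EuclideanSpace ℝ (Fin (m + 1))) (hx : x ∈ M) :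
    (∃ N : EuclideanSpace ℝ (Fin (m + 1)) → EuclideanSpace ℝ (Fin (m + 1)),
      IsUnitNormalNear M x N) ∧
    (∀ᶠ ε in 𝓝[>] (0 : ℝ),
      0 < μHE[m - 1] (smallSphere M x ε) ∧ μHE[m - 1] (smallSphere M x ε) < ⊤ ∧
      IntegrableOn (discreteVariationCurvature M x) (smallSphere M x ε) μHE[m - 1]) ∧
    ∀ N : EuclideanSpace ℝ (Fin (m + 1)) → EuclideanSpace ℝ (Fin (m + 1)),
      IsUnitNormalNear M x N →
      Tendsto
        (fun ε : ℝ => ⨍ y in smallSphere M x ε, discreteVariationCurvature M x y ∂μHE[m - 1])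
        (𝓝[>] 0) (𝓝 (sphereMean (shapeOperator M N x))) ∧
      absoluteVariationCurvature M x = sphereMean (shapeOperator M N x) ∧
      (∀ᶠ y in 𝓝[M \ {x}] x, discreteVariationCurvature M x y = ‖N x - N y‖ / ‖x - y‖) ∧
      Tendsto
        (fun ε : ℝ => ⨍ y in smallSphere M x ε, ‖N x - N y‖ / ‖x - y‖ ∂μHE[m - 1])
        (𝓝[>] 0) (𝓝 (sphereMean (shapeOperator M N x))) := by
  obtain ⟨W, φ, G, hW, hxW, -, h⟩ := hM.exists_definingFunction hx
  obtain ⟨-, hφ, hG0, hT⟩ := h x hxW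
  have hT := hT hx
  have hnhds := hW.mem_nhds hxW
  have hc : ∀ᶠ y in 𝓝 x, ContinuousAt φ y := by
    filter_upwards [hnhds] with y hy using (h y hy).2.1.hasFDerivAt.continuousAt
  have hMφ : ∀ᶠ y in 𝓝 x, y ∈ M ↔ φ y = 0 := by
    filter_upwards [hnhds] with y hy using (h y hy).1
  have hfr : Module.finrank ℝ (tangentSpaceAt M x) = m := by
    have : Fact (Module.finrank ℝ (EuclideanSpace ℝ (Fin (m + 1))) = m + 1) :=
      ⟨finrank_euclideanSpace_fin⟩
    rw [hT]
    exact Submodule.finrank_orthogonal_span_singleton hG0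
  have hfr1 : 1 ≤ Module.finrank ℝ (tangentSpaceAt M x) := hfr.symm ▸ hm
  have hfc : ∀ N, IsUnitNormalNear M x N →
      ∀ᶠ y in 𝓝[M \ {x}] x, ContinuousWithinAt (fun y => ‖N x - N y‖ / ‖x - y‖) M y := by
    intro N hN
    filter_upwards [nhdsWithin_mono x Set.sdiff_subset hN.eventually_continuousWithinAt,
      self_mem_nhdsWithin] with y hy hyM
    exact (continuousWithinAt_const.sub hy).norm.div
      (continuousWithinAt_const.sub continuousWithinAt_id).norm
      (norm_ne_zero_iff.2 (sub_ne_zero.2 (Ne.symm hyM.2)))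
  have hex := hM.exists_isUnitNormalNear hx
  have hmeas := eventually_measurableSet_smallSphere hc hMφ
  refine ⟨hex, ?_, fun N hN => ?_⟩
  · obtain ⟨N, hN⟩ := hex
    -- Only finiteness, positivity and integrability are needed, so any `δ < 1 / 2` serves.
    -- Integrability passes from the normal quotient to `Ω`, with which it agrees on `A_ε`.
    filter_upwards [eventually_abs_setAverage_smallSphere_sub_le hφ hG0 hc hMφ hx hT hfr1
      (hfc N hN) (fun η hη => abs_norm_sub_div_norm_sub_sub_le
        (hN.differentiableWithinAt hx).hasFDerivWithinAt hη)
      (show (0 : ℝ) < 1 / 4 by norm_num) (by norm_num),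
      eventually_forall_mem_smallSphere (hN.eventually_discreteVariationCurvature_eq hM hx)]
      with ε hε heq
    rw [hfr] at hε
    exact ⟨hε.2.1, hε.2.2.1, hε.2.2.2.1.congr_fun (fun y hy => (heq y hy).symm) hε.1⟩
  · have heq := hN.eventually_discreteVariationCurvature_eq hM hx
    have hlim : Tendsto
        (fun ε : ℝ => ⨍ y in smallSphere M x ε, ‖N x - N y‖ / ‖x - y‖ ∂μHE[m - 1])
        (𝓝[>] 0) (𝓝 (sphereMean (shapeOperator M N x))) := by
      have := tendsto_setAverage_smallSphere hφ hG0 hc hMφ hx hT hfr1 (hfc N hN)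
        (fun η hη => abs_norm_sub_div_norm_sub_sub_le
          (hN.differentiableWithinAt hx).hasFDerivWithinAt hη)
      unfold sphereMean
      rw [hfr] at this ⊢
      exact this
    have hlim' : Tendsto
        (fun ε : ℝ => ⨍ y in smallSphere M x ε, discreteVariationCurvature M x y ∂μHE[m - 1])
        (𝓝[>] 0) (𝓝 (sphereMean (shapeOperator M N x))) := by
      refine hlim.congr' ?_
      filter_upwards [eventually_forall_mem_smallSphere heq, hmeas] with ε hε hA
      exact setAverage_congr_fun hA (Eventually.of_forall fun y hy => (hε y hy).symm)
    exact ⟨hlim', hlim'.limUnder_eq, heq, hlim⟩
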